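/- A Boolean circuit with $n$ inputs is a finite directed acyclic graph in which each source node carries one of the input variables $x_1,\dots,x_n$ or a constant, each other node is a logic gate, i.e. a Boolean function of the values on its incoming edges, and exactly one gate, the output, has no outgoing edge. In a $\delta$-noisy circuit each gate, independently of the others, malfunctions with probability $\delta$, i.e. outputs the negation of the correct function of the values it receives; $C(x)$ denotes the random output on input $x$. A set $\mathcal F$ of Boolean functions (of arbitrary numbers of inputs) can be reliably computed by a set $\mathcal C$ of $\delta$-noisy circuits if there is $\varepsilon>0$ such that for every $f\in\mathcal F$, with $n$ inputs say, there is a circuit $C\in\mathcal C$ with $n$ inputs such that $\mathbb P(C(x)\neq f(x))\le \frac12-\varepsilon$ for all $x\in\{0,1\}^n$. For $k\ge 2$ let $\delta^*(k)$ be the supremum of those $\delta\in[0,\frac12]$ for which the set of all Boolean functions can be reliably computed by $\delta$-noisy circuits whose gates have at most $k$ inputs. **Theorem (Evans–Schulman, 1999).** For every integer $k\ge 2$, $$\delta^*(k)\ \le\ \frac12-\frac1{2\sqrt k}.$$ Moreover, if $0\le\delta\le\frac12$ and $k(1-2\delta)^2<1$, then already the set $\{\mathrm{XOR}_n : n\ge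 0\}$ cannot be reliably computed by $\delta$-noisy circuits whose gates have at most $k$ inputs, where $\mathrm{XOR}_n(x_1,\dots,x_n)=1$ if and only if an odd number of the $x_i$ equal $1$. -/

import Mathlib

/-- A Boolean function with `n` inputs. -/
abbrev BoolFun (n : ℕ) : Type := (Fin n → Bool) → Bool

/-- A Boolean circuit with `n` inputs and a single output: a finite directed acyclic graph, where
`u ∈ parents v` means that there is an edge from `u` to `v`. Each source node carries one of the
input variables or a constant, each other node carries a logic gate, which is a Boolean function of
the values on its incoming edges. The output is the unique gate with no outgoing edge. -/
structure BoolCircuit (n : ℕ) where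
  /-- the nodes -/
  V : Type
  [fintypeV : Fintype V]
  [decidableEqV : DecidableEq V]
  /-- the nodes with an edge to a given node -/
  parents : V → Finset V
  acyclic : ∀ v, ¬ Relation.TransGen (fun u w => u ∈ parents w) v v
  /-- a source node is an input variable (`Sum.inl i`) or a constant (`Sum.inr b`) -/
  source : ∀ v, ¬ (parents v).Nonempty → Fin n ⊕ Bool
  /-- the Boolean function of a gate -/
  gate : ∀ v, (parents v).Nonempty → ({u // u ∈ parents v} → Bool) → Bool
  /-- the output gate -/
  output : V
  output_isGate : (parents output).Nonempty
  output_isSink : ∀ v, output ∉ parents v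
  output_unique : ∀ v, (parents v).Nonempty → (∀ w, v ∉ parents w) → v = output

namespace BoolCircuit

attribute [instance] BoolCircuit.fintypeV BoolCircuit.decidableEqV

variable {n : ℕ} (C : BoolCircuit n)

/-- The gates of the circuit: the nodes with an incoming edge. -/
abbrev Gate : Type := {v : C.V // (C.parents v).Nonempty}

/-- The fan-in of a circuit: the largest number of inputs of one of its gates. -/
def fanIn : ℕ := Finset.univ.sup fun v : C.V => (C.parents v).card

theorem wellFounded_parents : WellFounded fun u v : C.V => u ∈ C.parents v := by
  have h : WellFounded (Relation.TransGen fun u v : C.V => u ∈ C.parents v) := by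
    have : Std.Irrefl (Relation.TransGen fun u v : C.V => u ∈ C.parents v) := ⟨C.acyclic⟩
    exact Finite.wellFounded_of_trans_of_irrefl _
  exact Subrelation.wf (fun h => Relation.TransGen.single h) h

/-- The value at a node on input `x`, when the malfunctioning gates are those `g` with
`z g = true`. A malfunctioning gate outputs the negation of the correct function of the
values that it receives; the source nodes do not malfunction. -/
noncomputable def value (x : Fin n → Bool) (z : C.Gate → Bool) : C.V → Bool :=
  C.wellFounded_parents.fix fun v rec =>
    if h : (C.parents v).Nonempty then
      xor (C.gate v h fun u => rec u.1 u.2) (z ⟨v, h⟩)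
    else Sum.elim x id (C.source v h)

theorem value_eq (x : Fin n → Bool) (z : C.Gate → Bool) (v : C.V) :
    C.value x z v =
      if h : (C.parents v).Nonempty then
        xor (C.gate v h fun u => C.value x z u.1) (z ⟨v, h⟩)
      else Sum.elim x id (C.source v h) :=
  C.wellFounded_parents.fix_eq _ v

/-- The probability that the set of malfunctioning gates is the one described by `z`, when the gates
malfunction independently, each with probability `δ`. -/
def malfunctionProb (δ : ℝ) (z : C.Gate → Bool) : ℝ :=
  ∏ g : C.Gate, if z g = true then δ else 1 - δ

/-- The probability that the `δ`-noisy circuit `C` on input `x` does not output `f x`. -/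
noncomputable def errorProb (δ : ℝ) (f : BoolFun n) (x : Fin n → Bool) : ℝ :=
  ∑ z : C.Gate → Bool with C.value x z C.output ≠ f x, C.malfunctionProb δ z

end BoolCircuit

/-- The set `F` of Boolean functions (`F n` holds those with `n` inputs) can be reliably computed by
the set `𝒞` of circuits, made of `δ`-noisy gates: some `ε > 0` serves all functions in `F`. -/
def ReliablyComputable (δ : ℝ) (F : ∀ n, Set (BoolFun n)) (𝒞 : ∀ n, Set (BoolCircuit n)) : Prop :=
  ∃ ε : ℝ, 0 < ε ∧ ∀ n, ∀ f ∈ F n, ∃ C ∈ 𝒞 n, ∀ x, C.errorProb δ f x ≤ 1 / 2 - ε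

/-- All Boolean functions. -/
def allFunctions (n : ℕ) : Set (BoolFun n) := Set.univ

/-- The function `XOR` of `n` bits: true if and only if the number of true inputs is odd. -/
def xorFun (n : ℕ) : BoolFun n := fun x => decide (Odd (Finset.univ.filter fun i => x i = true).card)

/-- The functions `XOR`, one for each number of inputs. -/
def xorFunctions (n : ℕ) : Set (BoolFun n) := {xorFun n}

/-- The circuits all of whose gates have at most `k` inputs. -/
def fanInCircuits (k n : ℕ) : Set (BoolCircuit n) := {C | C.fanIn ≤ k}

/-- The threshold noise `δ*(k)`: the supremum of the noise levels `δ` in `[0, 1/2]` at which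
all Boolean functions can be reliably computed by `δ`-noisy circuits of fan-in at most `k`. -/
noncomputable def noiseThreshold (k : ℕ) : ℝ :=
  sSup {δ : ℝ | 0 ≤ δ ∧ δ ≤ 1 / 2 ∧ ReliablyComputable δ allFunctions (fanInCircuits k)}

/-!
The obstruction is quantitative: a noisy circuit of fan-in `k` transmits only a bounded total amount
of information about its inputs, whereas `XOR` depends on every one of its `n` inputs.

Compare a circuit on two inputs `x`, `y` that differ only in coordinate `i`. For a set `W` of nodes,
measure how well the values on `W` distinguish `x` from `y` by the triangular discrimination
`∑ (p - q)² / (p + q)` of their two joint laws `p`, `q`. It decreases under data processing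
(`triDiscr_map_le`), and a noisy bit contracts it: with `η = (1 - 2δ)²` and a gate `v` that is not an
ancestor of `W`, the discrimination of `W ∪ {v}` is at most `1 - η` times that of `W` plus `η` times
that of `W ∪ parents v` (`nodeDiscr_insert_gate_le`). Replacing gates by their parents until only
sources are left bounds the discrimination of the output by twice the sum of `η ^ length` over all
paths from a source carrying `x_i` to the output (`nodeDiscr_le_pathSum`).

Summed over all `i`, these path sums are at most `1` when `k * η ≤ 1`, since a gate has at most `k`
parents and each edge costs a factor `η` (`sum_pathSum_inputIndicator_le_one`). On the other hand,
if the circuit computes `XOR` with error at most `1/2 - ε`, then each of the `n` discriminations is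
at least `8 ε²`, so `4 ε² n ≤ 1`, which fails for large `n`.
-/

/-! ### Triangular discrimination -/

/-- The triangular discrimination `∑ (p - q)² / (p + q)` of two nonnegative weight functions.
Terms with `p + q = 0` contribute `0` by the convention `0 / 0 = 0`, as they should. -/
noncomputable def triDiscr {α : Type*} [Fintype α] (p q : α → ℝ) : ℝ :=
  ∑ a, (p a - q a) ^ 2 / (p a + q a)

theorem triDiscr_self {α : Type*} [Fintype α] (p : α → ℝ) : triDiscr p p = 0 := by
  simp [triDiscr]

theorem triDiscr_le_sum {α : Type*} [Fintype α] {p q : α → ℝ} (hp : ∀ a, 0 ≤ p a)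
    (hq : ∀ a, 0 ≤ q a) : triDiscr p q ≤ ∑ a, (p a + q a) := by
  refine Finset.sum_le_sum fun a _ => ?_
  refine div_le_of_le_mul₀ (add_nonneg (hp a) (hq a)) (add_nonneg (hp a) (hq a)) ?_
  nlinarith [mul_nonneg (hp a) (hq a)]

/-- Sedrakyan's inequality for the terms of the triangular discrimination; vanishing denominators
are allowed. -/
theorem sq_sub_div_add_sum_le {ι : Type*} (s : Finset ι) {p q : ι → ℝ} (hp : ∀ a, 0 ≤ p a)
    (hq : ∀ a, 0 ≤ q a) :
    (∑ a ∈ s, p a - ∑ a ∈ s, q a) ^ 2 / (∑ a ∈ s, p a + ∑ a ∈ s, q a) ≤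
      ∑ a ∈ s, (p a - q a) ^ 2 / (p a + q a) := by
  have hs : ∀ a, 0 ≤ p a + q a := fun a => add_nonneg (hp a) (hq a)
  have hd : ∀ a, 0 ≤ (p a - q a) ^ 2 / (p a + q a) := fun a => div_nonneg (sq_nonneg _) (hs a)
  rw [← Finset.sum_add_distrib, ← Finset.sum_sub_distrib]
  refine div_le_of_le_mul₀ (Finset.sum_nonneg fun a _ => hs a)
    (Finset.sum_nonneg fun a _ => hd a) ?_
  refine Finset.sum_sq_le_sum_mul_sum_of_sq_le_mul s (fun a _ => hd a) (fun a _ => hs a) ?_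
  intro a _
  rcases (hs a).eq_or_lt with h | h
  · have h1 : p a = 0 := by linarith [hp a, hq a]
    have h2 : q a = 0 := by linarith [hp a, hq a]
    simp [h1, h2]
  · rw [div_mul_cancel₀ _ h.ne']

/-- One step of a binary symmetric channel with flip probability `δ` contracts the excess of the
discrimination of a bit over the trivial discrimination by the factor `(1 - 2δ)²`. -/
theorem triDiscr_bsc_le {δ p₀ p₁ q₀ q₁ : ℝ} (hδ₀ : 0 ≤ δ) (hδ₁ : δ ≤ 1) (hp₀ : 0 ≤ p₀)
    (hp₁ : 0 ≤ p₁) (hq₀ : 0 ≤ q₀) (hq₁ : 0 ≤ q₁) :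
    (((1 - δ) * p₀ + δ * p₁) - ((1 - δ) * q₀ + δ * q₁)) ^ 2 /
          (((1 - δ) * p₀ + δ * p₁) + ((1 - δ) * q₀ + δ * q₁)) +
        (((1 - δ) * p₁ + δ * p₀) - ((1 - δ) * q₁ + δ * q₀)) ^ 2 /
          (((1 - δ) * p₁ + δ * p₀) + ((1 - δ) * q₁ + δ * q₀)) ≤
      (1 - (1 - 2 * δ) ^ 2) * (((p₀ + p₁) - (q₀ + q₁)) ^ 2 / ((p₀ + p₁) + (q₀ + q₁))) +
        (1 - 2 * δ) ^ 2 * ((p₀ - q₀) ^ 2 / (p₀ + q₀) + (p₁ - q₁) ^ 2 / (p₁ + q₁)) := by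
  -- In terms of sums `s` and differences `d`, the excess of a pair over its total is
  -- `(d₀ s₁ - d₁ s₀)² / (s₀ s₁ (s₀ + s₁))`; the channel multiplies the determinant in the
  -- numerator by `1 - 2δ` and can only increase the product `s₀ s₁`.
  have excess : ∀ {s₀ s₁ : ℝ} (d₀ d₁ : ℝ), 0 < s₀ → 0 < s₁ → d₀ ^ 2 / s₀ + d₁ ^ 2 / s₁ =
      (d₀ + d₁) ^ 2 / (s₀ + s₁) + (d₀ * s₁ - d₁ * s₀) ^ 2 / (s₀ * s₁ * (s₀ + s₁)) := by
    intro s₀ s₁ d₀ d₁ h₀ h₁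
    have h : s₀ + s₁ ≠ 0 := by positivity
    field_simp
    ring
  have key : ∀ {s₀ s₁ : ℝ} (d₀ d₁ : ℝ), 0 < s₀ → 0 < s₁ →
      ((1 - δ) * d₀ + δ * d₁) ^ 2 / ((1 - δ) * s₀ + δ * s₁) +
        ((1 - δ) * d₁ + δ * d₀) ^ 2 / ((1 - δ) * s₁ + δ * s₀) ≤
      (1 - (1 - 2 * δ) ^ 2) * ((d₀ + d₁) ^ 2 / (s₀ + s₁)) +
        (1 - 2 * δ) ^ 2 * (d₀ ^ 2 / s₀ + d₁ ^ 2 / s₁) := by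
    intro s₀ s₁ d₀ d₁ h₀ h₁
    have hδ : 0 ≤ 1 - δ := by linarith
    have hmul : s₀ * s₁ ≤ ((1 - δ) * s₀ + δ * s₁) * ((1 - δ) * s₁ + δ * s₀) := by
      nlinarith [mul_nonneg (mul_nonneg hδ₀ hδ) (sq_nonneg (s₀ - s₁))]
    have hpos : ∀ {a b : ℝ}, 0 < a → 0 < b → 0 < (1 - δ) * a + δ * b := by
      intro a b ha hb
      rcases hδ₀.eq_or_lt with h | h
      · simpa [← h] using ha
      · have := mul_pos h hb
        have := mul_nonneg hδ ha.le
        linarith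
    rw [excess _ _ (hpos h₀ h₁) (hpos h₁ h₀), excess d₀ d₁ h₀ h₁,
      show (1 - δ) * s₀ + δ * s₁ + ((1 - δ) * s₁ + δ * s₀) = s₀ + s₁ by ring,
      show (1 - δ) * d₀ + δ * d₁ + ((1 - δ) * d₁ + δ * d₀) = d₀ + d₁ by ring,
      show ((1 - δ) * d₀ + δ * d₁) * ((1 - δ) * s₁ + δ * s₀) -
        ((1 - δ) * d₁ + δ * d₀) * ((1 - δ) * s₀ + δ * s₁) =
          (1 - 2 * δ) * (d₀ * s₁ - d₁ * s₀) by ring]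
    have h : ((1 - 2 * δ) * (d₀ * s₁ - d₁ * s₀)) ^ 2 /
        (((1 - δ) * s₀ + δ * s₁) * ((1 - δ) * s₁ + δ * s₀) * (s₀ + s₁)) ≤
        ((1 - 2 * δ) * (d₀ * s₁ - d₁ * s₀)) ^ 2 / (s₀ * s₁ * (s₀ + s₁)) := by
      gcongr
    rw [mul_pow, mul_div_assoc, mul_div_assoc] at h
    rw [mul_pow, mul_div_assoc]
    linarith
  have zero : ∀ {p q : ℝ}, 0 ≤ p → 0 ≤ q → p + q = 0 → p = 0 ∧ q = 0 := fun hp hq h =>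
    ⟨by linarith, by linarith⟩
  -- If one of the two values has weight `0`, both sides agree.
  have degenerate : ∀ d s : ℝ, ((1 - δ) * d) ^ 2 / ((1 - δ) * s) + (δ * d) ^ 2 / (δ * s) =
      d ^ 2 / s := by
    have scale : ∀ c d s : ℝ, (c * d) ^ 2 / (c * s) = c * (d ^ 2 / s) := by
      intro c d s
      rcases eq_or_ne c 0 with h | h
      · simp [h]
      · rw [mul_pow, sq c, mul_assoc, mul_div_mul_left _ _ h, mul_div_assoc]
    intro d s
    rw [scale, scale]
    ring
  rcases (add_nonneg hp₀ hq₀).eq_or_lt with h₀ | h₀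
  · obtain ⟨rfl, rfl⟩ := zero hp₀ hq₀ h₀.symm
    have := degenerate (p₁ - q₁) (p₁ + q₁)
    simp only [mul_sub, mul_add] at this
    simp only [mul_zero, zero_add, add_zero, sub_zero, ne_eq, OfNat.ofNat_ne_zero,
      not_false_eq_true, zero_pow, zero_div]
    linarith
  rcases (add_nonneg hp₁ hq₁).eq_or_lt with h₁ | h₁
  · obtain ⟨rfl, rfl⟩ := zero hp₁ hq₁ h₁.symm
    have := degenerate (p₀ - q₀) (p₀ + q₀)
    simp only [mul_sub, mul_add] at this
    simp only [mul_zero, zero_add, add_zero, sub_zero, ne_eq, OfNat.ofNat_ne_zero,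
      not_false_eq_true, zero_pow, zero_div]
    linarith
  · convert key (p₀ - q₀) (p₁ - q₁) h₀ h₁ using 3 <;> ring_nf

/-! ### Laws of random variables on a finite weighted space -/

/-- The law of `A` under the weight function `μ`: the total weight of each fibre. -/
noncomputable def law {Ω α : Type*} [Fintype Ω] [DecidableEq α] (μ : Ω → ℝ) (A : Ω → α) (a : α) :
    ℝ :=
  ∑ ω, if A ω = a then μ ω else 0

section law

variable {Ω α β : Type*} [Fintype Ω] [DecidableEq α] [DecidableEq β] {μ : Ω → ℝ}

theorem law_nonneg (hμ : ∀ ω, 0 ≤ μ ω) (A : Ω → α) (a : α) : 0 ≤ law μ A a :=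
  Finset.sum_nonneg fun ω _ => by split_ifs <;> simp [hμ]

theorem sum_law [Fintype α] (A : Ω → α) : ∑ a, law μ A a = ∑ ω, μ ω := by
  simp only [law]
  rw [Finset.sum_comm]
  simp

theorem law_comp [Fintype α] (A : Ω → α) (φ : α → β) (b : β) :
    law μ (fun ω => φ (A ω)) b = ∑ a with φ a = b, law μ A a := by
  simp only [law]
  rw [Finset.sum_comm]
  refine Finset.sum_congr rfl fun ω _ => ?_
  rw [Finset.sum_ite_eq]
  simp

theorem law_fst [Fintype α] [Fintype β] (A : Ω → α) (B : Ω → β) (a : α) :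
    law μ A a = ∑ b, law μ (fun ω => (A ω, B ω)) (a, b) := by
  simp only [law]
  rw [Finset.sum_comm]
  refine Finset.sum_congr rfl fun ω _ => ?_
  by_cases h : A ω = a <;> simp [h]

/-- The data processing inequality for the triangular discrimination. -/
theorem triDiscr_map_le [Fintype α] [Fintype β] (hμ : ∀ ω, 0 ≤ μ ω) (A A' : Ω → α) (φ : α → β) :
    triDiscr (law μ fun ω => φ (A ω)) (law μ fun ω => φ (A' ω)) ≤
      triDiscr (law μ A) (law μ A') := by
  unfold triDiscr
  rw [← Finset.sum_fiberwise Finset.univ φ]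
  refine Finset.sum_le_sum fun b _ => ?_
  rw [law_comp, law_comp]
  exact sq_sub_div_add_sum_le _ (law_nonneg hμ A) (law_nonneg hμ A')

end law

namespace BoolCircuit

/-! ### Path sums in a circuit -/

section pathSum

variable {n : ℕ} (C : BoolCircuit n) {R : Type*} [Semiring R]

/-- The sum, over all directed paths ending at a given node, of `a` at the first node of the path
times `r ^ length`. -/
noncomputable def pathSum (a : C.V → R) (r : R) : C.V → R :=
  C.wellFounded_parents.fix fun v rec => a v + r * ∑ u : {u // u ∈ C.parents v}, rec u.1 u.2

theorem pathSum_eq (a : C.V → R) (r : R) (v : C.V) :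
    C.pathSum a r v = a v + r * ∑ u ∈ C.parents v, C.pathSum a r u := by
  rw [← Finset.sum_coe_sort]
  exact C.wellFounded_parents.fix_eq _ v

theorem pathSum_nonneg {a : C.V → ℝ} {r : ℝ} (ha : ∀ v, 0 ≤ a v) (hr : 0 ≤ r) (v : C.V) :
    0 ≤ C.pathSum a r v := by
  induction v using C.wellFounded_parents.induction with
  | _ v ih =>
    rw [pathSum_eq]
    exact add_nonneg (ha v) (mul_nonneg hr (Finset.sum_nonneg ih))

/-- The number of directed paths ending at a node. It strictly increases along edges, so it orders
the nodes topologically. -/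
noncomputable def pathCount : C.V → ℕ :=
  C.pathSum (fun _ => 1) 1

theorem pathCount_eq (v : C.V) : C.pathCount v = 1 + ∑ u ∈ C.parents v, C.pathCount u := by
  rw [pathCount, pathSum_eq, one_mul]

theorem pathCount_lt {u v : C.V} (h : u ∈ C.parents v) : C.pathCount u < C.pathCount v := by
  rw [C.pathCount_eq v]
  have := Finset.single_le_sum (f := C.pathCount) (fun _ _ => Nat.zero_le _) h
  omega

/-- The indicator function of the source nodes that carry the input variable `i`. -/
noncomputable def inputIndicator (i : Fin n) (v : C.V) : ℝ :=
  if h : (C.parents v).Nonempty then 0 else if C.source v h = Sum.inl i then 1 else 0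

theorem inputIndicator_nonneg (i : Fin n) (v : C.V) : 0 ≤ C.inputIndicator i v := by
  unfold inputIndicator
  split_ifs <;> simp

/-- Each edge of a path costs a factor `r` and each gate has at most `k` parents, so if `k * r ≤ 1`
then the weighted paths from all inputs to a node have total weight at most `1`. -/
theorem sum_pathSum_inputIndicator_le_one {k : ℕ} {r : ℝ} (hr : 0 ≤ r) (hkr : k * r ≤ 1)
    (hC : C.fanIn ≤ k) (v : C.V) : ∑ i, C.pathSum (C.inputIndicator i) r v ≤ 1 := by
  induction v using C.wellFounded_parents.induction with
  | _ v ih =>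
    simp only [C.pathSum_eq _ r v]
    rw [Finset.sum_add_distrib, ← Finset.mul_sum, Finset.sum_comm]
    by_cases h : (C.parents v).Nonempty
    · have h1 := Finset.sum_le_sum ih
      have h2 : ((C.parents v).card : ℝ) ≤ k := by
        exact_mod_cast (Finset.le_sup (f := fun v => (C.parents v).card)
          (Finset.mem_univ v)).trans hC
      simp only [Finset.sum_const, nsmul_eq_mul, mul_one] at h1
      have h3 := mul_le_mul_of_nonneg_left (h1.trans h2) hr
      simp only [inputIndicator, h, dite_true, Finset.sum_const_zero, zero_add]
      linarith
    · rw [Finset.not_nonempty_iff_eq_empty.mp h]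
      simp only [inputIndicator, h, dite_false, Finset.sum_empty, mul_zero, add_zero]
      rcases C.source v h with j | b
      · simp
      · simp

end pathSum

/-! ### The malfunction probabilities -/

section malfunction

variable {n : ℕ} (C : BoolCircuit n) {δ : ℝ}

theorem malfunctionProb_nonneg (hδ₀ : 0 ≤ δ) (hδ₁ : δ ≤ 1) (z : C.Gate → Bool) :
    0 ≤ C.malfunctionProb δ z :=
  Finset.prod_nonneg fun g _ => by split_ifs <;> linarith

theorem sum_malfunctionProb (δ : ℝ) : ∑ z, C.malfunctionProb δ z = 1 := by
  unfold malfunctionProb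
  have h := Fintype.prod_sum (R := ℝ) (fun (_ : C.Gate) (b : Bool) => if b = true then δ else 1 - δ)
  rw [← h]
  simp

/-- The malfunction of a gate is independent of every quantity that ignores this gate. -/
theorem sum_malfunctionProb_mul_ite (g : C.Gate) (b : Bool) {G : (C.Gate → Bool) → ℝ}
    (hG : ∀ z c, G (Function.update z g c) = G z) :
    ∑ z, (if z g = b then C.malfunctionProb δ z * G z else 0) =
      (if b = true then δ else 1 - δ) * ∑ z, C.malfunctionProb δ z * G z := by
  set w : Bool → ℝ := fun b => if b = true then δ else 1 - δ with hw
  have hprob : ∀ z, C.malfunctionProb δ z = w (z g) * ∏ g' ∈ Finset.univ.erase g, w (z g') :=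
    fun z => (Finset.mul_prod_erase _ _ (Finset.mem_univ g)).symm
  have hw1 : w b + w (!b) = 1 := by cases b <;> simp [hw]
  -- Flipping the bit `z g` exchanges the two values of this bit and changes only its own factor.
  let flip : (C.Gate → Bool) → (C.Gate → Bool) := fun z => Function.update z g (!z g)
  have hflip : Function.Involutive flip := by
    intro z
    simp [flip]
  have hswap : w (!b) * ∑ z, (if z g = b then C.malfunctionProb δ z * G z else 0) =
      w b * ∑ z, (if z g = !b then C.malfunctionProb δ z * G z else 0) := by
    rw [Finset.mul_sum, Finset.mul_sum]
    refine Fintype.sum_equiv hflip.toPerm _ _ fun z => ?_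
    change _ = w b * (if flip z g = !b then C.malfunctionProb δ (flip z) * G (flip z) else 0)
    have h1 : flip z g = !z g := by simp [flip]
    have h2 : ∏ g' ∈ Finset.univ.erase g, w (flip z g') = ∏ g' ∈ Finset.univ.erase g, w (z g') :=
      Finset.prod_congr rfl fun g' hg' => by simp [flip, Finset.ne_of_mem_erase hg']
    rw [hprob, hprob, h2, h1, hG z]
    by_cases h : z g = b
    · simp only [h, if_true]
      ring
    · simp [h]
  have hsplit : ∑ z, C.malfunctionProb δ z * G z =
      ∑ z, (if z g = b then C.malfunctionProb δ z * G z else 0) +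
        ∑ z, (if z g = !b then C.malfunctionProb δ z * G z else 0) := by
    rw [← Finset.sum_add_distrib]
    refine Finset.sum_congr rfl fun z _ => ?_
    cases z g <;> cases b <;> simp
  change _ = w b * _
  rw [hsplit, mul_add, ← hswap]
  linear_combination (-∑ z, (if z g = b then C.malfunctionProb δ z * G z else 0)) * hw1

/-- Adding the noise of the gate `g` to a bit `Y` that ignores this noise passes `Y` through a binary
symmetric channel. -/
theorem law_pair_xor {α : Type*} [DecidableEq α] (g : C.Gate) {B : (C.Gate → Bool) → α}
    {Y : (C.Gate → Bool) → Bool} (hB : ∀ z c, B (Function.update z g c) = B z)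
    (hY : ∀ z c, Y (Function.update z g c) = Y z) (a : α) (y : Bool) :
    law (C.malfunctionProb δ) (fun z => (B z, xor (Y z) (z g))) (a, y) =
      (1 - δ) * law (C.malfunctionProb δ) (fun z => (B z, Y z)) (a, y) +
        δ * law (C.malfunctionProb δ) (fun z => (B z, Y z)) (a, !y) := by
  have h : ∀ y' b, (if b = true then δ else 1 - δ) *
      law (C.malfunctionProb δ) (fun z => (B z, Y z)) (a, y') =
        ∑ z, (if z g = b then
          C.malfunctionProb δ z * (if (B z, Y z) = (a, y') then 1 else 0) else 0) := by
    intro y' b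
    rw [C.sum_malfunctionProb_mul_ite g b fun z c => by simp only [hB, hY]]
    simp [law]
  have h0 := h y false
  have h1 := h (!y) true
  simp only [Bool.false_eq_true, if_false] at h0
  simp only [if_true] at h1
  rw [h0, h1, ← Finset.sum_add_distrib]
  refine Finset.sum_congr rfl fun z _ => ?_
  by_cases hb : B z = a
  · cases hz : z g <;> cases hy : Y z <;> cases y <;> simp [hb, hz, hy]
  · simp [hb]

end malfunction

/-! ### Contraction of the discrimination in a noisy circuit -/

section nodeDiscr

variable {n : ℕ} (C : BoolCircuit n) {δ : ℝ}

/-- The values on the nodes in `W`, extended by `false` to all nodes. -/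
noncomputable def maskedValue (W : Finset C.V) (x : Fin n → Bool) (z : C.Gate → Bool) (v : C.V) :
    Bool :=
  decide (v ∈ W) && C.value x z v

/-- How well the values of the nodes in `W` distinguish the inputs `x` and `y`: the triangular
discrimination of their joint laws. -/
noncomputable def nodeDiscr (δ : ℝ) (x y : Fin n → Bool) (W : Finset C.V) : ℝ :=
  triDiscr (law (C.malfunctionProb δ) (C.maskedValue W x))
    (law (C.malfunctionProb δ) (C.maskedValue W y))

theorem nodeDiscr_le_two (hδ₀ : 0 ≤ δ) (hδ₁ : δ ≤ 1) (x y : Fin n → Bool) (W : Finset C.V) :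
    C.nodeDiscr δ x y W ≤ 2 := by
  have hμ := C.malfunctionProb_nonneg hδ₀ hδ₁
  refine (triDiscr_le_sum (law_nonneg hμ _) (law_nonneg hμ _)).trans_eq ?_
  rw [Finset.sum_add_distrib, sum_law, sum_law, sum_malfunctionProb]
  norm_num

/-- A malfunction of `g` does not affect the nodes that do not come after `g`. -/
theorem value_update (x : Fin n → Bool) (z : C.Gate → Bool) (g : C.Gate) (c : Bool) (u : C.V)
    (hne : u ≠ g) (hle : C.pathCount u ≤ C.pathCount g) :
    C.value x (Function.update z g c) u = C.value x z u := by
  induction u using C.wellFounded_parents.induction with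
  | _ u ih =>
    rw [value_eq, value_eq C x z]
    split_ifs with h
    · have h1 : ∀ p : {p // p ∈ C.parents u},
          C.value x (Function.update z g c) p.1 = C.value x z p.1 := by
        intro p
        have hp := C.pathCount_lt p.2
        refine ih p.1 p.2 ?_ (by omega)
        intro he
        rw [he] at hp
        omega
      have h2 : (⟨u, h⟩ : C.Gate) ≠ g := fun he => hne (by rw [← he])
      simp only [h1, Function.update_of_ne h2]
    · rfl

/-- The contraction step: a gate `g` that comes after all nodes of `W` can be replaced by its parents
with weight `(1 - 2δ)²`, or dropped with the complementary weight. -/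
theorem nodeDiscr_insert_gate_le (hδ₀ : 0 ≤ δ) (hδ₁ : δ ≤ 1) (x y : Fin n → Bool) (g : C.Gate)
    (W : Finset C.V) (hg : g.1 ∉ W) (hW : ∀ u ∈ W, C.pathCount u ≤ C.pathCount g) :
    C.nodeDiscr δ x y (insert g.1 W) ≤ (1 - (1 - 2 * δ) ^ 2) * C.nodeDiscr δ x y W +
      (1 - 2 * δ) ^ 2 * C.nodeDiscr δ x y (W ∪ C.parents g) := by
  have hμ := C.malfunctionProb_nonneg hδ₀ hδ₁
  -- The output of the gate `g` before its own noise is added.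
  let Y : (Fin n → Bool) → (C.Gate → Bool) → Bool := fun x z =>
    C.gate g g.2 fun u => C.value x z u.1
  have hB : ∀ x z c, C.maskedValue W x (Function.update z g c) = C.maskedValue W x z := by
    intro x z c
    funext u
    unfold maskedValue
    by_cases hu : u ∈ W
    · rw [C.value_update x z g c u (fun h => hg (h ▸ hu)) (hW u hu)]
    · simp [hu]
  have hY : ∀ x z c, Y x (Function.update z g c) = Y x z := by
    intro x z c
    simp only [Y]
    congr 1
    funext u
    have hu := C.pathCount_lt u.2
    exact C.value_update x z g c u (fun h => by rw [h] at hu; omega) hu.le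
  -- The noisy value of `g` together with `W`.
  have h1 : C.nodeDiscr δ x y (insert g.1 W) ≤
      triDiscr (law (C.malfunctionProb δ) fun z => (C.maskedValue W x z, xor (Y x z) (z g)))
        (law (C.malfunctionProb δ) fun z => (C.maskedValue W y z, xor (Y y z) (z g))) := by
    obtain ⟨φ, h⟩ : ∃ φ : (C.V → Bool) × Bool → C.V → Bool, ∀ x,
        C.maskedValue (insert g.1 W) x = fun z =>
          φ (C.maskedValue W x z, xor (Y x z) (z g)) := by
      refine ⟨fun a => Function.update a.1 g.1 a.2, fun x => ?_⟩
      funext z u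
      by_cases hu : u = g.1
      · subst hu
        simp only [maskedValue, Finset.mem_insert_self, decide_true, Bool.true_and,
          Function.update_self]
        rw [value_eq, dif_pos g.2]
      · simp [maskedValue, hu]
    unfold nodeDiscr
    rw [h x, h y]
    exact triDiscr_map_le hμ _ _ φ
  -- The noiseless value of `g` is a function of the values of the parents.
  have h2 : triDiscr (law (C.malfunctionProb δ) fun z => (C.maskedValue W x z, Y x z))
        (law (C.malfunctionProb δ) fun z => (C.maskedValue W y z, Y y z)) ≤
      C.nodeDiscr δ x y (W ∪ C.parents g) := by
    obtain ⟨φ, h⟩ : ∃ φ : (C.V → Bool) → (C.V → Bool) × Bool, ∀ x,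
        (fun z => (C.maskedValue W x z, Y x z)) = fun z =>
          φ (C.maskedValue (W ∪ C.parents g) x z) := by
      refine ⟨fun a => (fun u => decide (u ∈ W) && a u, C.gate g g.2 fun u => a u.1),
        fun x => ?_⟩
      funext z
      refine Prod.ext ?_ ?_
      · funext u
        by_cases hu : u ∈ W <;> simp [maskedValue, hu]
      · simp only [Y]
        congr 1
        funext u
        simp [maskedValue, u.2]
    rw [h x, h y]
    exact triDiscr_map_le hμ _ _ φ
  have h3 : triDiscr
        (law (C.malfunctionProb δ) fun z => (C.maskedValue W x z, xor (Y x z) (z g)))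
        (law (C.malfunctionProb δ) fun z => (C.maskedValue W y z, xor (Y y z) (z g))) ≤
      (1 - (1 - 2 * δ) ^ 2) * C.nodeDiscr δ x y W + (1 - 2 * δ) ^ 2 *
        triDiscr (law (C.malfunctionProb δ) fun z => (C.maskedValue W x z, Y x z))
          (law (C.malfunctionProb δ) fun z => (C.maskedValue W y z, Y y z)) := by
    unfold nodeDiscr triDiscr
    rw [Fintype.sum_prod_type, Fintype.sum_prod_type, Finset.mul_sum, Finset.mul_sum,
      ← Finset.sum_add_distrib]
    refine Finset.sum_le_sum fun a _ => ?_
    simp only [Fintype.sum_bool, C.law_pair_xor g (hB x) (hY x), C.law_pair_xor g (hB y) (hY y),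
      law_fst (C.maskedValue W x) (Y x), law_fst (C.maskedValue W y) (Y y), Bool.not_true,
      Bool.not_false]
    exact triDiscr_bsc_le hδ₀ hδ₁ (law_nonneg hμ _ _) (law_nonneg hμ _ _) (law_nonneg hμ _ _)
      (law_nonneg hμ _ _)
  have h4 := mul_le_mul_of_nonneg_left h2 (sq_nonneg (1 - 2 * δ))
  linarith

/-- If `x` and `y` differ at most in coordinate `i`, then the values on `W` distinguish them at most
as well as the weighted paths from the input `i` to `W` allow. -/
theorem nodeDiscr_le_pathSum (hδ₀ : 0 ≤ δ) (hδ₁ : δ ≤ 1) {x y : Fin n → Bool} {i : Fin n}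
    (hxy : ∀ j, j ≠ i → x j = y j) (W : Finset C.V) :
    C.nodeDiscr δ x y W ≤ 2 * ∑ v ∈ W, C.pathSum (C.inputIndicator i) ((1 - 2 * δ) ^ 2) v := by
  set φ := C.pathSum (C.inputIndicator i) ((1 - 2 * δ) ^ 2) with hφ
  have hφ0 : ∀ v, 0 ≤ φ v := C.pathSum_nonneg (C.inputIndicator_nonneg i) (sq_nonneg _)
  -- Replacing a gate by its parents lowers the total number of paths that end in `W`.
  induction hN : ∑ v ∈ W, C.pathCount v using Nat.strong_induction_on generalizing W with
  | _ N ih =>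
    by_cases hgate : ∃ v ∈ W, (C.parents v).Nonempty
    · obtain ⟨v, hv, hmax⟩ := Finset.exists_max_image (W.filter fun v => (C.parents v).Nonempty)
        C.pathCount (by
          obtain ⟨v, hv, hv'⟩ := hgate
          exact ⟨v, Finset.mem_filter.mpr ⟨hv, hv'⟩⟩)
      obtain ⟨hvW, hvg⟩ := Finset.mem_filter.mp hv
      have hle : ∀ u ∈ W.erase v, C.pathCount u ≤ C.pathCount v := by
        intro u hu
        by_cases hug : (C.parents u).Nonempty
        · exact hmax u (Finset.mem_filter.mpr ⟨Finset.mem_of_mem_erase hu, hug⟩)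
        · rw [C.pathCount_eq u, C.pathCount_eq v, Finset.not_nonempty_iff_eq_empty.mp hug]
          simp
      have hstep := C.nodeDiscr_insert_gate_le hδ₀ hδ₁ x y ⟨v, hvg⟩ (W.erase v)
        (Finset.notMem_erase v W) hle
      simp only [Finset.insert_erase hvW] at hstep
      have hcount := Finset.add_sum_erase W C.pathCount hvW
      rw [C.pathCount_eq v] at hcount
      have hunion : ∑ u ∈ W.erase v ∪ C.parents v, C.pathCount u ≤
          ∑ u ∈ W.erase v, C.pathCount u + ∑ u ∈ C.parents v, C.pathCount u := by
        rw [← Finset.sum_union_inter]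
        exact Nat.le_add_right _ _
      have ih1 := ih _ (by omega) (W.erase v) rfl
      have ih2 := ih _ (by omega) (W.erase v ∪ C.parents v) rfl
      have hunionφ : ∑ u ∈ W.erase v ∪ C.parents v, φ u ≤
          ∑ u ∈ W.erase v, φ u + ∑ u ∈ C.parents v, φ u := by
        rw [← Finset.sum_union_inter]
        exact le_add_of_nonneg_right (Finset.sum_nonneg fun u _ => hφ0 u)
      have hφv : φ v = (1 - 2 * δ) ^ 2 * ∑ u ∈ C.parents v, φ u := by
        rw [hφ, pathSum_eq]
        simp [inputIndicator, hvg]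
      have hη : 0 ≤ 1 - (1 - 2 * δ) ^ 2 := by nlinarith
      have m1 := mul_le_mul_of_nonneg_left ih1 hη
      have m2 := mul_le_mul_of_nonneg_left (ih2.trans
        (mul_le_mul_of_nonneg_left hunionφ zero_le_two)) (sq_nonneg (1 - 2 * δ))
      rw [← Finset.add_sum_erase W φ hvW, hφv]
      linarith
    · have hsource : ∀ v ∈ W, ¬ (C.parents v).Nonempty := fun v hv h => hgate ⟨v, hv, h⟩
      by_cases hi : ∃ v, ∃ hv : v ∈ W, C.source v (hsource v hv) = Sum.inl i
      · obtain ⟨v, hv, hvi⟩ := hi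
        have h1 : φ v = 1 := by
          rw [hφ, pathSum_eq, Finset.not_nonempty_iff_eq_empty.mp (hsource v hv)]
          simp [inputIndicator, hsource v hv, hvi]
        have h2 := Finset.single_le_sum (f := φ) (fun u _ => hφ0 u) hv
        linarith [C.nodeDiscr_le_two hδ₀ hδ₁ x y W]
      · have h : C.maskedValue W x = C.maskedValue W y := by
          funext z v
          unfold maskedValue
          by_cases hv : v ∈ W
          · rw [value_eq, value_eq C y, dif_neg (hsource v hv), dif_neg (hsource v hv)]
            rcases hs : C.source v (hsource v hv) with j | b
            · simp only [Sum.elim_inl]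
              rw [hxy j]
              rintro rfl
              exact hi ⟨v, hv, hs⟩
            · rfl
          · simp [hv]
        unfold nodeDiscr
        rw [h, triDiscr_self]
        exact mul_nonneg zero_le_two (Finset.sum_nonneg fun u _ => hφ0 u)

/-! ### Reliable computation forces discrimination -/

/-- A circuit whose error probabilities on `x` and `y` are at most `1/2 - ε` distinguishes them if
the computed function does. -/
theorem le_nodeDiscr_output (hδ₀ : 0 ≤ δ) (hδ₁ : δ ≤ 1) {f : BoolFun n} {x y : Fin n → Bool}
    (hf : f x ≠ f y) {ε : ℝ} (hε : 0 < ε) (hx : C.errorProb δ f x ≤ 1 / 2 - ε)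
    (hy : C.errorProb δ f y ≤ 1 / 2 - ε) : 8 * ε ^ 2 ≤ C.nodeDiscr δ x y {C.output} := by
  have hμ := C.malfunctionProb_nonneg hδ₀ hδ₁
  set p := law (C.malfunctionProb δ) (fun z => C.value x z C.output) with hp
  set q := law (C.malfunctionProb δ) (fun z => C.value y z C.output) with hq
  have hle : triDiscr p q ≤ C.nodeDiscr δ x y {C.output} := by
    obtain ⟨φ, h⟩ : ∃ φ : (C.V → Bool) → Bool, ∀ x, (fun z => C.value x z C.output) = fun z =>
        φ (C.maskedValue {C.output} x z) := by
      refine ⟨fun a => a C.output, fun x => ?_⟩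
      funext z
      simp [maskedValue]
    rw [hp, hq, h x, h y]
    exact triDiscr_map_le hμ _ _ φ
  refine le_trans ?_ hle
  have herr : ∀ x, C.errorProb δ f x =
      law (C.malfunctionProb δ) (fun z => C.value x z C.output) (!f x) := by
    intro x
    rw [errorProb, Finset.sum_filter, law]
    refine Finset.sum_congr rfl fun z _ => ?_
    cases C.value x z C.output <;> cases f x <;> simp
  rw [herr] at hx hy
  have hsum : ∀ x, law (C.malfunctionProb δ) (fun z => C.value x z C.output) true +
      law (C.malfunctionProb δ) (fun z => C.value x z C.output) false = 1 := by
    intro x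
    rw [← C.sum_malfunctionProb δ, ← sum_law (fun z => C.value x z C.output), Fintype.sum_bool]
  have hpsum : p true + p false = 1 := hsum x
  have hqsum : q true + q false = 1 := hsum y
  have hp0 : ∀ b, 0 ≤ p b := law_nonneg hμ _
  have hq0 : ∀ b, 0 ≤ q b := law_nonneg hμ _
  rw [← hp] at hx
  rw [← hq] at hy
  have hd : (2 * ε) ^ 2 ≤ (p true - q true) ^ 2 := by
    rw [sq_le_sq, abs_of_pos (by positivity)]
    cases hfx : f x <;> cases hfy : f y
    · exact absurd (hfx.trans hfy.symm) hf
    · rw [hfx] at hx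
      rw [hfy] at hy
      simp only [Bool.not_false, Bool.not_true] at hx hy
      exact le_abs.mpr (Or.inr (by linarith))
    · rw [hfx] at hx
      rw [hfy] at hy
      simp only [Bool.not_false, Bool.not_true] at hx hy
      exact le_abs.mpr (Or.inl (by linarith))
    · exact absurd (hfx.trans hfy.symm) hf
  have hd' : (p false - q false) ^ 2 = (p true - q true) ^ 2 := by
    rw [show p false - q false = -(p true - q true) by linarith]
    ring
  have hdpos : 0 < (p true - q true) ^ 2 := lt_of_lt_of_le (by positivity) hd
  have hpos : ∀ b, (p b - q b) ^ 2 = (p true - q true) ^ 2 → 0 < p b + q b := by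
    intro b hb
    refine (add_nonneg (hp0 b) (hq0 b)).lt_of_ne fun h => ?_
    have h1 : p b = 0 := by linarith [hp0 b, hq0 b]
    have h2 : q b = 0 := by linarith [hp0 b, hq0 b]
    rw [h1, h2] at hb
    norm_num at hb
    rw [← hb] at hdpos
    norm_num at hdpos
  have ht := hpos true rfl
  have hf' := hpos false hd'
  have hS : p false + q false = 2 - (p true + q true) := by linarith
  rw [hS] at hf'
  rw [triDiscr, Fintype.sum_bool, hd', hS, div_add_div _ _ ht.ne' hf'.ne',
    le_div_iff₀ (mul_pos ht hf')]
  -- The two denominators add up to `2`, so their product is at most `1`.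
  have hprod : (p true + q true) * (2 - (p true + q true)) ≤ 1 := by
    nlinarith [sq_nonneg (p true + q true - 1)]
  have h1 := mul_le_mul_of_nonneg_left hprod (show 0 ≤ 8 * ε ^ 2 by positivity)
  nlinarith

end nodeDiscr

end BoolCircuit

/-- A circuit of fan-in `k` with `k (1 - 2δ)² ≤ 1` that computes a function depending on all of its
`n` inputs at a common point `x` has few inputs. -/
theorem card_inputs_mul_sq_le_one {n k : ℕ} {δ ε : ℝ} (hδ₀ : 0 ≤ δ) (hδ₁ : δ ≤ 1)
    (hkδ : (k : ℝ) * (1 - 2 * δ) ^ 2 ≤ 1) (hε : 0 < ε) {C : BoolCircuit n} (hC : C.fanIn ≤ k)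
    {f : BoolFun n} {x : Fin n → Bool} (hf : ∀ i, f x ≠ f (Function.update x i (!x i)))
    (herr : ∀ y, C.errorProb δ f y ≤ 1 / 2 - ε) : n * (4 * ε ^ 2) ≤ 1 := by
  have h : ∀ i, 4 * ε ^ 2 ≤ C.pathSum (C.inputIndicator i) ((1 - 2 * δ) ^ 2) C.output := by
    intro i
    have h1 := C.le_nodeDiscr_output hδ₀ hδ₁ (hf i) hε (herr _) (herr _)
    have h2 := C.nodeDiscr_le_pathSum (x := x) (y := Function.update x i (!x i)) hδ₀ hδ₁ (i := i)
      (fun j hj => (Function.update_of_ne hj _ _).symm) {C.output}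
    rw [Finset.sum_singleton] at h2
    linarith
  calc (n : ℝ) * (4 * ε ^ 2) = ∑ _i : Fin n, 4 * ε ^ 2 := by simp
    _ ≤ ∑ i, C.pathSum (C.inputIndicator i) ((1 - 2 * δ) ^ 2) C.output :=
      Finset.sum_le_sum fun i _ => h i
    _ ≤ 1 := C.sum_pathSum_inputIndicator_le_one (sq_nonneg _) hkδ hC _

theorem xorFun_ne_update_false {n : ℕ} (i : Fin n) :
    xorFun n (fun _ => false) ≠ xorFun n (Function.update (fun _ => false) i (!false)) := by
  have h : (Finset.univ.filter fun j : Fin n =>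
      Function.update (fun _ => false) i (!false) j = true) = {i} := by
    ext j
    by_cases hj : j = i
    · subst hj
      simp
    · simp [hj]
  simp only [xorFun, h]
  simp

theorem not_reliablyComputable_xorFunctions {k : ℕ} {δ : ℝ} (hδ₀ : 0 ≤ δ) (hδ₁ : δ ≤ 1)
    (hkδ : (k : ℝ) * (1 - 2 * δ) ^ 2 ≤ 1) :
    ¬ ReliablyComputable δ xorFunctions (fanInCircuits k) := by
  rintro ⟨ε, hε, h⟩
  obtain ⟨n, hn⟩ := exists_nat_gt (1 / (4 * ε ^ 2))
  obtain ⟨C, hC, herr⟩ := h n (xorFun n) rfl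
  have h1 := card_inputs_mul_sq_le_one hδ₀ hδ₁ hkδ hε hC xorFun_ne_update_false herr
  rw [div_lt_iff₀ (by positivity)] at hn
  linarith

theorem theorem2p4 (k : ℕ) (hk : 2 ≤ k) :
    noiseThreshold k ≤ 1 / 2 - 1 / (2 * Real.sqrt k) ∧
    ∀ δ : ℝ, 0 ≤ δ → δ ≤ 1 / 2 → (k : ℝ) * (1 - 2 * δ) ^ 2 < 1 →
      ¬ ReliablyComputable δ xorFunctions (fanInCircuits k) := by
  have hxor : ∀ δ : ℝ, 0 ≤ δ → δ ≤ 1 / 2 → (k : ℝ) * (1 - 2 * δ) ^ 2 < 1 →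
      ¬ ReliablyComputable δ xorFunctions (fanInCircuits k) := fun δ h0 h1 h =>
    not_reliablyComputable_xorFunctions h0 (by linarith) h.le
  refine ⟨?_, hxor⟩
  have hk1 : (1 : ℝ) ≤ k := by exact_mod_cast (by omega : 1 ≤ k)
  have hs1 : 1 ≤ Real.sqrt k := Real.one_le_sqrt.mpr hk1
  have hs0 : 0 < Real.sqrt k := by linarith
  have hhalf : 1 / (2 * Real.sqrt k) = 1 / Real.sqrt k / 2 := by
    field_simp
  have hinv : 1 / Real.sqrt k ≤ 1 := (div_le_one hs0).mpr hs1
  -- Nonnegativity of the bound covers the value `0` of a supremum over the empty set.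
  refine Real.sSup_le ?_ (by rw [hhalf]; linarith)
  rintro δ ⟨h0, h1, ε, hε, h⟩
  by_contra! hlt
  rw [hhalf] at hlt
  refine hxor δ h0 h1 ?_ ⟨ε, hε, fun n f _ => h n f (Set.mem_univ f)⟩
  have h2 : 1 - 2 * δ < 1 / Real.sqrt k := by linarith
  calc (k : ℝ) * (1 - 2 * δ) ^ 2 < k * (1 / Real.sqrt k) ^ 2 := by
        gcongr
        linarith
    _ = 1 := by
        rw [div_pow, Real.sq_sqrt (by linarith)]
        field_simp
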